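/- Let $d\ge 1$. For $x\in[0,1]^d$ write $(x,1]=\prod_{i=1}^d(x_i,1]$, $[0,x]=\prod_{i=1}^d[0,x_i]$, and let $$K(x,y)=\int_{[0,1]^d}\mathbf 1_{(x,1]}(t)\,\mathbf 1_{(y,1]}(t)\,dt .$$ For points $p_1,\dots,p_N\in[0,1]^d$ let $D_N^*(p_1,\dots,p_N)=\sup_{x\in[0,1]^d}\bigl|\lambda([0,x])-\frac1N\sum_{n=1}^N\mathbf 1_{[0,x]}(p_n)\bigr|$ be the star discrepancy, and let $\|f\|_2^2=\int_{[0,1]^d}f(x)^2\,dx$. A $d$-dimensional Hilbert space filling curve is a continuous map $H:[0,1]\to[0,1]^d$ which, for every $k\ge 0$, carries the $2^{dk}$ successive closed intervals of length $2^{-dk}$ onto the $2^{dk}$ closed dyadic cubes of side $2^{-k}$, each cube being visited exactly once and consecutive cubes sharing a $(d-1)$-dimensional face. Hilbert space filling curve (HSFC) samples of size $N$ are $X_i=H(x_i)$, $i=1,\dots,N$, where $x_1,\dots,x_N$ are independent and $x_i$ is uniformly distributed on $I_i=[\frac{i-1}N,\frac iN]$ (so that $X_i\sim U(E_i)$, $E_i=H(I_i)$).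 There is a constant $\gamma_0$ with $0<\gamma_0\le 1$, depending only on $d$, such that the following holds for all integers $b\ge 1$, $m\ge 1$, $N=b^m$, for all HSFC samples $X=(X_1,\dots,X_N)$ of size $N$ in $[0,1]^d$ (for any Hilbert space filling curve $H$), and for all $0<\varepsilon<1$. With probability at least $1-\varepsilon$, simultaneously for all real functions $f,g\in L^2([0,1]^d)$ with $$f^2(x)=\int_{[0,1]^d}K(x,y)\,g^2(y)\,dy\qquad\text{for all }x\in[0,1]^d,$$ the inequalities $$\Bigl(1-\frac{D_N^*(X)}{\gamma}\Bigr)\|f\|_2^2\;\le\;\frac1N\sum_{j=1}^N f^2(X_j)\;\le\;\Bigl(1+\frac{D_N^*(X)}{\gamma}\Bigr)\|f\|_2^2$$ hold for $\gamma=\gamma_0$, and also for every $\gamma\in(0,1]$ such that $\gamma\|g\|_2^2\le\|f\|_2^2$. -/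

import Mathlib

open MeasureTheory ProbabilityTheory

/-- The unit cube `[0,1]^d`. -/
def unitCube (d : ℕ) : Set (Fin d → ℝ) := Set.Icc 0 1

/-- The closed dyadic cube of side `2^{-k}` with lower corner `c / 2^k`. -/
def dyadicCube (d k : ℕ) (c : Fin d → Fin (2 ^ k)) : Set (Fin d → ℝ) :=
  Set.Icc (fun i => ((c i : ℕ) : ℝ) / 2 ^ k) (fun i => (((c i : ℕ) : ℝ) + 1) / 2 ^ k)

/-- `H` is a `d`-dimensional Hilbert space filling curve: a continuous curve `[0,1] → [0,1]^d` that,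
at every level `k`, carries the `2^{dk}` successive closed intervals of length `2^{-dk}` onto the
`2^{dk}` closed dyadic cubes of side `2^{-k}`, each cube being visited exactly once, in an order
in which any two consecutive cubes share a `(d-1)`-dimensional face. (Level `k = 0` says that
`H` maps `[0,1]` onto `[0,1]^d`. The nesting of the orders at successive levels is automatic, since
the image of a subinterval lies in the image of the interval.) -/
structure IsHilbertCurve (d : ℕ) (H : ℝ → Fin d → ℝ) : Prop where
  continuousOn : ContinuousOn H (Set.Icc 0 1)
  exists_order : ∀ k : ℕ, ∃ c : Fin (2 ^ (d * k)) ≃ (Fin d → Fin (2 ^ k)),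
    (∀ j : Fin (2 ^ (d * k)),
      H '' Set.Icc (((j : ℕ) : ℝ) / 2 ^ (d * k)) ((((j : ℕ) : ℝ) + 1) / 2 ^ (d * k)) =
        dyadicCube d k (c j)) ∧
    (∀ j j' : Fin (2 ^ (d * k)), (j' : ℕ) = (j : ℕ) + 1 →
      ∑ i, |(((c j' i : ℕ) : ℤ) - ((c j i : ℕ) : ℤ))| = 1)

/-- The random points `X 0, …, X (N-1)` are Hilbert space filling curve stratified samples for the
curve `H`: `X i = H (x i)`, where the `x i` are independent and `x i` is uniformly distributed on
the `i`-th of the `N` successive closed intervals of length `1 / N` in `[0,1]`. -/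
def IsHSFCSample {Ω : Type*} [MeasurableSpace Ω] (P : Measure Ω) {d : ℕ} (N : ℕ)
    (H : ℝ → Fin d → ℝ) (X : Fin N → Ω → Fin d → ℝ) : Prop :=
  ∃ x : Fin N → Ω → ℝ,
    (∀ i, Measurable (x i)) ∧
    iIndepFun x P ∧
    (∀ i : Fin N, pdf.IsUniform (x i)
      (Set.Icc (((i : ℕ) : ℝ) / N) ((((i : ℕ) : ℝ) + 1) / N)) P volume) ∧
    ∀ i ω, X i ω = H (x i ω)

/-- The star discrepancy
`sup_{x ∈ [0,1]^d} | λ([0,x]) - (1/N) ∑_n 1_{[0,x]}(p_n) |` of the points `p_1, …, p_N`. -/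
noncomputable def starDiscrepancy {d N : ℕ} (p : Fin N → Fin d → ℝ) : ℝ :=
  ⨆ x : unitCube d, |volume.real (Set.Icc 0 (x : Fin d → ℝ)) -
    (∑ n, (Set.Icc 0 (x : Fin d → ℝ)).indicator (fun _ => (1 : ℝ)) (p n)) / N|

/-- The box `(x,1] = ∏_i (x_i, 1]`. -/
def upperBox {d : ℕ} (x : Fin d → ℝ) : Set (Fin d → ℝ) :=
  Set.univ.pi fun i => Set.Ioc (x i) 1

/-- The kernel `K(x,y) = ∫_{[0,1]^d} 1_{(x,1]}(t) 1_{(y,1]}(t) dt`. -/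
noncomputable def samplingKernel {d : ℕ} (x y : Fin d → ℝ) : ℝ :=
  ∫ t in unitCube d,
    (upperBox x).indicator (fun _ => (1 : ℝ)) t * (upperBox y).indicator (fun _ => (1 : ℝ)) t

/-- The squared norm `‖f‖²` of a function in `L²([0,1]^d)`. -/
noncomputable def l2NormSq {d : ℕ} (f : (Fin d → ℝ) → ℝ) : ℝ :=
  ∫ x in unitCube d, f x ^ 2

/-- `f, g ∈ L²([0,1]^d)`, and `f²(x) = ∫_{[0,1]^d} K(x,y) g²(y) dy` for all `x ∈ [0,1]^d`. -/
structure IsKernelRepresented {d : ℕ} (f g : (Fin d → ℝ) → ℝ) : Prop where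
  memLp_left : MemLp f 2 (volume.restrict (unitCube d))
  memLp_right : MemLp g 2 (volume.restrict (unitCube d))
  sq_eq : ∀ x ∈ unitCube d, f x ^ 2 = ∫ y in unitCube d, samplingKernel x y * g y ^ 2

/-- The two-sided sampling inequality for `f` at the points `p_1, …, p_N` with constant `γ`. -/
def SamplingInequality {d N : ℕ} (γ : ℝ) (p : Fin N → Fin d → ℝ) (f : (Fin d → ℝ) → ℝ) : Prop :=
  (1 - starDiscrepancy p / γ) * l2NormSq f ≤ (1 / (N : ℝ)) * ∑ j, f (p j) ^ 2 ∧
  (1 / (N : ℝ)) * ∑ j, f (p j) ^ 2 ≤ (1 + starDiscrepancy p / γ) * l2NormSq f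

/-! The inequality is deterministic: it holds for any points of the cube, and chance enters only
because the samples lie there almost surely. For fixed `y`, `K(·, y)` is an average over `t` in
`(y,1]` of the indicators of `x < t`, that is, up to null sets, of anchored boxes `[0,t]`. Its
quadrature error is thus the local discrepancy integrated over `(y,1]`, at most `D* · K(0,y)`.
Integrating against `g²` bounds the error for `f²` by `D* · f(0)²` (`abs_l2NormSq_sub_average_le`).
It remains to compare `f(0)²` with the norms: `K ≤ 1` gives `f(0)² ≤ ‖g‖²`, and `K(x,y) ≥ K(x,0)
K(0,y)` gives `2^{-d} f(0)² ≤ ‖f‖²`, hence `γ₀ = 2^{-d}`. -/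

lemma volume_unitCube (d : ℕ) : volume (unitCube d) = 1 := by
  simp [unitCube, Real.volume_Icc_pi]

instance isProbabilityMeasure_restrict_unitCube (d : ℕ) :
    IsProbabilityMeasure (volume.restrict (unitCube d)) :=
  ⟨by simp [volume_unitCube]⟩

lemma measurableSet_unitCube (d : ℕ) : MeasurableSet (unitCube d) := measurableSet_Icc

lemma measurableSet_upperBox {d : ℕ} (x : Fin d → ℝ) : MeasurableSet (upperBox x) :=
  MeasurableSet.univ_pi fun _ => measurableSet_Ioc

lemma upperBox_subset_unitCube {d : ℕ} {x : Fin d → ℝ} (hx : x ∈ unitCube d) :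
    upperBox x ⊆ unitCube d := fun _ ht =>
  ⟨fun i => (hx.1 i).trans (ht i trivial).1.le, fun i => (ht i trivial).2⟩

/-! ### Product form of the kernel -/

lemma samplingKernel_eq_prod {d : ℕ} {x y : Fin d → ℝ} (hx : x ∈ unitCube d)
    (hy : y ∈ unitCube d) : samplingKernel x y = ∏ i, (1 - max (x i) (y i)) := by
  have hinter : upperBox x ∩ upperBox y = upperBox (x ⊔ y) := by
    ext t
    simp only [upperBox, Set.mem_inter_iff, Set.mem_pi, Set.mem_univ, forall_true_left,
      Set.mem_Ioc, Pi.sup_apply, sup_lt_iff]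
    grind
  have hxy : x ⊔ y ∈ unitCube d := ⟨le_sup_of_le_left hx.1, sup_le hx.2 hy.2⟩
  have hmul : (fun t => (upperBox x).indicator (fun _ => (1 : ℝ)) t *
      (upperBox y).indicator (fun _ => (1 : ℝ)) t) =
      (upperBox (x ⊔ y)).indicator (fun _ => (1 : ℝ)) := by
    rw [← hinter]
    ext t
    by_cases h1 : t ∈ upperBox x <;> by_cases h2 : t ∈ upperBox y <;> simp [h1, h2]
  rw [samplingKernel, hmul, integral_indicator (measurableSet_upperBox _),
    Measure.restrict_restrict (measurableSet_upperBox _),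
    Set.inter_eq_left.2 (upperBox_subset_unitCube hxy)]
  simp only [integral_const, MeasurableSet.univ, measureReal_restrict_apply, Set.univ_inter,
    smul_eq_mul, mul_one]
  have := Real.volume_pi_Ioc_toReal (a := x ⊔ y) (b := 1) hxy.2
  simpa [upperBox, Measure.real] using this

/-- The value `∏ (1 - max (x i) (y i))` of the kernel at points of the unit cube. -/
def kernelProd {d : ℕ} (x y : Fin d → ℝ) : ℝ := ∏ i, (1 - max (x i) (y i))

lemma continuous_kernelProd {d : ℕ} :
    Continuous fun z : (Fin d → ℝ) × (Fin d → ℝ) => kernelProd z.1 z.2 := by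
  unfold kernelProd
  fun_prop

lemma kernelProd_nonneg {d : ℕ} {x y : Fin d → ℝ} (hx : x ∈ unitCube d) (hy : y ∈ unitCube d) :
    0 ≤ kernelProd x y :=
  Finset.prod_nonneg fun i _ => sub_nonneg.2 (max_le (hx.2 i) (hy.2 i))

lemma kernelProd_le_one {d : ℕ} {x y : Fin d → ℝ} (hx : x ∈ unitCube d) (hy : y ∈ unitCube d) :
    kernelProd x y ≤ 1 :=
  Finset.prod_le_one (fun i _ => sub_nonneg.2 (max_le (hx.2 i) (hy.2 i)))
    fun i _ => sub_le_self _ (le_max_of_le_left (hx.1 i))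

lemma zero_mem_unitCube (d : ℕ) : (0 : Fin d → ℝ) ∈ unitCube d := ⟨le_rfl, zero_le_one⟩

/-- Coordinatewise, `(1 - a)(1 - b) ≤ 1 - max a b`, because both factors lie in `[0,1]`. -/
lemma kernelProd_mul_le {d : ℕ} {x y : Fin d → ℝ} (hx : x ∈ unitCube d) (hy : y ∈ unitCube d) :
    kernelProd x 0 * kernelProd 0 y ≤ kernelProd x y := by
  unfold kernelProd
  rw [← Finset.prod_mul_distrib]
  refine Finset.prod_le_prod (fun i _ => ?_) fun i _ => ?_
  all_goals
    have hx0 : 0 ≤ x i := hx.1 i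
    have hx1 : x i ≤ 1 := hx.2 i
    have hy0 : 0 ≤ y i := hy.1 i
    have hy1 : y i ≤ 1 := hy.2 i
    simp only [Pi.zero_apply, max_eq_left hx0, max_eq_right hy0]
  · exact mul_nonneg (sub_nonneg.2 hx1) (sub_nonneg.2 hy1)
  · rcases max_cases (x i) (y i) with ⟨h, -⟩ | ⟨h, -⟩ <;> rw [h] <;> nlinarith

lemma kernelProd_eq_integral {d : ℕ} {x y : Fin d → ℝ} (hx : x ∈ unitCube d)
    (hy : y ∈ unitCube d) :
    kernelProd x y = ∫ t in unitCube d, (upperBox x).indicator (fun _ => (1 : ℝ)) t *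
      (upperBox y).indicator (fun _ => (1 : ℝ)) t :=
  (samplingKernel_eq_prod hx hy).symm

/-! ### Quadrature error of the kernel and star discrepancy -/

lemma ae_mem_upperBox_zero (d : ℕ) :
    ∀ᵐ t ∂volume.restrict (unitCube d), t ∈ upperBox (0 : Fin d → ℝ) := by
  have h : (unitCube d : Set (Fin d → ℝ)) =ᵐ[volume] upperBox (0 : Fin d → ℝ) := by
    have := (Measure.univ_pi_Ioc_ae_eq_Icc (μ := fun _ : Fin d => (volume : Measure ℝ))
      (f := 0) (g := 1)).symm
    simpa [unitCube, upperBox, volume_pi] using this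
  rw [Measure.restrict_congr_set h]
  exact ae_restrict_mem (measurableSet_upperBox _)

lemma kernelProd_zero_eq_integral {d : ℕ} {y : Fin d → ℝ} (hy : y ∈ unitCube d) :
    kernelProd 0 y = ∫ t in unitCube d, (upperBox y).indicator (fun _ => (1 : ℝ)) t := by
  rw [kernelProd_eq_integral (zero_mem_unitCube d) hy]
  refine integral_congr_ae ?_
  filter_upwards [ae_mem_upperBox_zero d] with t ht
  simp [ht]

/-- Strict and weak inequality differ only on the null hyperplanes `t i = p i`; this turns the
half-open boxes of the kernel into the closed ones of the discrepancy. -/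
lemma ae_indicator_upperBox_eq {d : ℕ} {p : Fin d → ℝ} (hp : p ∈ unitCube d) :
    ∀ᵐ t ∂volume.restrict (unitCube d), (upperBox p).indicator (fun _ => (1 : ℝ)) t =
      (Set.Icc 0 t).indicator (fun _ => (1 : ℝ)) p := by
  have hne : ∀ᵐ t ∂volume.restrict (unitCube d), ∀ i, t i ≠ p i := by
    refine ae_restrict_of_ae (ae_all_iff.2 fun i => ?_)
    simpa [volume_pi] using
      (Measure.ae_eval_ne (μ := fun _ : Fin d => (volume : Measure ℝ)) i (p i))
  filter_upwards [hne, ae_restrict_mem (measurableSet_unitCube d)] with t ht htC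
  have hiff : t ∈ upperBox p ↔ p ∈ Set.Icc 0 t := by
    constructor
    · exact fun h => ⟨hp.1, fun i => (h i trivial).1.le⟩
    · exact fun h i _ => ⟨lt_of_le_of_ne (h.2 i) (ht i).symm, htC.2 i⟩
  by_cases h : t ∈ upperBox p
  · simp only [Set.indicator_of_mem h, Set.indicator_of_mem (hiff.1 h)]
  · simp only [Set.indicator_of_notMem h, Set.indicator_of_notMem (mt hiff.2 h)]

lemma abs_discrepancy_le {d N : ℕ} (p : Fin N → Fin d → ℝ) {t : Fin d → ℝ}
    (ht : t ∈ unitCube d) :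
    |volume.real (Set.Icc 0 t) -
      (∑ n, (Set.Icc 0 t).indicator (fun _ => (1 : ℝ)) (p n)) / N| ≤ starDiscrepancy p := by
  -- A real supremum needs a bound: volume and empirical frequency both lie in `[0,1]`, so 1 works.
  refine le_ciSup (f := fun x : unitCube d => |volume.real (Set.Icc 0 (x : Fin d → ℝ)) -
    (∑ n, (Set.Icc 0 (x : Fin d → ℝ)).indicator (fun _ => (1 : ℝ)) (p n)) / N|)
    ⟨1, ?_⟩ ⟨t, ht⟩
  rintro _ ⟨x, rfl⟩
  have hvol : volume.real (Set.Icc 0 (x : Fin d → ℝ)) ≤ 1 := by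
    have h : volume (Set.Icc 0 (x : Fin d → ℝ)) ≤ 1 :=
      (measure_mono (Set.Icc_subset_Icc_right x.2.2)).trans_eq (volume_unitCube d)
    exact ENNReal.toReal_mono ENNReal.one_ne_top h
  have hsum0 : 0 ≤ ∑ n, (Set.Icc 0 (x : Fin d → ℝ)).indicator (fun _ => (1 : ℝ)) (p n) :=
    Finset.sum_nonneg fun n _ => Set.indicator_nonneg (fun _ _ => zero_le_one) _
  have hsum1 : ∑ n, (Set.Icc 0 (x : Fin d → ℝ)).indicator (fun _ => (1 : ℝ)) (p n) ≤ N := by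
    calc _ ≤ ∑ _n : Fin N, (1 : ℝ) :=
          Finset.sum_le_sum fun n _ => Set.indicator_le_self' (fun _ _ => zero_le_one) _
      _ = N := by simp
  have h0 := div_nonneg hsum0 (Nat.cast_nonneg (α := ℝ) N)
  have h1 := div_le_one_of_le₀ hsum1 (Nat.cast_nonneg (α := ℝ) N)
  have hv0 : 0 ≤ volume.real (Set.Icc 0 (x : Fin d → ℝ)) := measureReal_nonneg
  exact abs_le.2 ⟨by linarith, by linarith⟩

lemma starDiscrepancy_nonneg {d N : ℕ} (p : Fin N → Fin d → ℝ) : 0 ≤ starDiscrepancy p :=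
  (abs_nonneg _).trans (abs_discrepancy_le p (zero_mem_unitCube d))

lemma integrable_indicator_mul_indicator {d : ℕ} (x y : Fin d → ℝ) :
    Integrable (fun t => (upperBox x).indicator (fun _ => (1 : ℝ)) t *
      (upperBox y).indicator (fun _ => (1 : ℝ)) t) (volume.restrict (unitCube d)) := by
  refine Integrable.of_bound (C := 1) ?_ (ae_of_all _ fun t => ?_)
  · exact ((measurable_const.indicator (measurableSet_upperBox x)).mul
      (measurable_const.indicator (measurableSet_upperBox y))).aestronglyMeasurable
  · by_cases h1 : t ∈ upperBox x <;> by_cases h2 : t ∈ upperBox y <;> simp [h1, h2]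

lemma integral_indicator_upperBox {d : ℕ} {t : Fin d → ℝ} (ht : t ∈ unitCube d) :
    ∫ x in unitCube d, (upperBox x).indicator (fun _ => (1 : ℝ)) t =
      volume.real (Set.Icc 0 t) := by
  have hsub : Set.univ.pi (fun i => Set.Ico (0 : ℝ) (t i)) ⊆ unitCube d := fun x hx =>
    ⟨fun i => (hx i trivial).1, fun i => (hx i trivial).2.le.trans (ht.2 i)⟩
  have hmeas : MeasurableSet (Set.univ.pi (fun i => Set.Ico (0 : ℝ) (t i))) :=
    MeasurableSet.univ_pi fun _ => measurableSet_Ico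
  have h : ∫ x in unitCube d, (upperBox x).indicator (fun _ => (1 : ℝ)) t =
      ∫ x in unitCube d,
        (Set.univ.pi (fun i => Set.Ico (0 : ℝ) (t i))).indicator (fun _ => (1 : ℝ)) x := by
    refine setIntegral_congr_fun (measurableSet_unitCube d) fun x hx => ?_
    have hiff : t ∈ upperBox x ↔ x ∈ Set.univ.pi (fun i => Set.Ico (0 : ℝ) (t i)) :=
      ⟨fun h i _ => ⟨hx.1 i, (h i trivial).1⟩, fun h i _ => ⟨(h i trivial).2, ht.2 i⟩⟩
    by_cases h : t ∈ upperBox x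
    · simp only [Set.indicator_of_mem h, Set.indicator_of_mem (hiff.1 h)]
    · simp only [Set.indicator_of_notMem h, Set.indicator_of_notMem (mt hiff.2 h)]
  rw [h, integral_indicator hmeas, Measure.restrict_restrict hmeas, Set.inter_eq_left.2 hsub]
  simp only [integral_const, MeasurableSet.univ, measureReal_restrict_apply, Set.univ_inter,
    smul_eq_mul, mul_one]
  have h1 := Real.volume_pi_Ico_toReal (a := 0) (b := t) ht.1
  have h2 := Real.volume_Icc_pi_toReal (a := 0) (b := t) ht.1
  exact h1.trans h2.symm

/-- Fubini: for fixed `t`, the `x` with `t ∈ (x,1]` fill `[0,t)`. -/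
lemma integral_kernelProd_left {d : ℕ} {y : Fin d → ℝ} (hy : y ∈ unitCube d) :
    ∫ x in unitCube d, kernelProd x y = ∫ t in unitCube d,
      volume.real (Set.Icc 0 t) * (upperBox y).indicator (fun _ => (1 : ℝ)) t := by
  have hset : MeasurableSet {z : (Fin d → ℝ) × (Fin d → ℝ) | z.2 ∈ upperBox z.1} := by
    simp only [upperBox, Set.mem_pi, Set.mem_univ, forall_true_left, Set.mem_Ioc,
      Set.ofPred_forall, Set.ofPred_and]
    exact MeasurableSet.iInter fun i => (measurableSet_lt (by fun_prop) (by fun_prop)).inter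
      (measurableSet_le (by fun_prop) measurable_const)
  have hint : Integrable (Function.uncurry fun x t : Fin d → ℝ =>
      (upperBox x).indicator (fun _ => (1 : ℝ)) t * (upperBox y).indicator (fun _ => (1 : ℝ)) t)
      ((volume.restrict (unitCube d)).prod (volume.restrict (unitCube d))) := by
    refine Integrable.of_bound (C := 1) ?_ (ae_of_all _ fun z => ?_)
    · have h1 : Measurable fun z : (Fin d → ℝ) × (Fin d → ℝ) =>
          (upperBox z.1).indicator (fun _ => (1 : ℝ)) z.2 :=
        (measurable_const (a := (1 : ℝ))).indicator hset
      have h2 : Measurable fun z : (Fin d → ℝ) × (Fin d → ℝ) =>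
          (upperBox y).indicator (fun _ => (1 : ℝ)) z.2 :=
        (measurable_const.indicator (measurableSet_upperBox y)).comp measurable_snd
      exact (h1.mul h2).aestronglyMeasurable
    · by_cases h1 : z.2 ∈ upperBox z.1 <;> by_cases h2 : z.2 ∈ upperBox y <;>
        simp [Function.uncurry, h1, h2]
  calc ∫ x in unitCube d, kernelProd x y
      = ∫ x in unitCube d, ∫ t in unitCube d, (upperBox x).indicator (fun _ => (1 : ℝ)) t *
          (upperBox y).indicator (fun _ => (1 : ℝ)) t :=
        setIntegral_congr_fun (measurableSet_unitCube d) fun x hx => kernelProd_eq_integral hx hy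
    _ = ∫ t in unitCube d, ∫ x in unitCube d, (upperBox x).indicator (fun _ => (1 : ℝ)) t *
          (upperBox y).indicator (fun _ => (1 : ℝ)) t := integral_integral_swap hint
    _ = _ := setIntegral_congr_fun (measurableSet_unitCube d) fun t ht => by
        simp only [integral_mul_const, integral_indicator_upperBox ht]

lemma abs_integral_kernelProd_sub_average_le {d N : ℕ} {p : Fin N → Fin d → ℝ}
    (hp : ∀ n, p n ∈ unitCube d) {y : Fin d → ℝ} (hy : y ∈ unitCube d) :
    |(∫ x in unitCube d, kernelProd x y) - (∑ n, kernelProd (p n) y) / N| ≤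
      starDiscrepancy p * kernelProd 0 y := by
  have hvol : Integrable (fun t => volume.real (Set.Icc 0 t) *
      (upperBox y).indicator (fun _ => (1 : ℝ)) t) (volume.restrict (unitCube d)) := by
    -- On the cube the volume of `[0,t]` is `∏ i, t i`, which is visibly measurable.
    have h : Integrable (fun t : Fin d → ℝ => (∏ i, t i) *
        (upperBox y).indicator (fun _ => (1 : ℝ)) t) (volume.restrict (unitCube d)) := by
      refine Integrable.of_bound (C := 1) ?_ ?_
      · have hm : Measurable fun t : Fin d → ℝ => ∏ i, t i := by fun_prop
        exact (hm.mul (measurable_const.indicator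
          (measurableSet_upperBox y))).aestronglyMeasurable
      · filter_upwards [ae_restrict_mem (measurableSet_unitCube d)] with t ht
        have h0 : 0 ≤ ∏ i, t i := Finset.prod_nonneg fun i _ => ht.1 i
        have h1 : ∏ i, t i ≤ 1 := Finset.prod_le_one (fun i _ => ht.1 i) fun i _ => ht.2 i
        rw [norm_mul, Real.norm_of_nonneg h0,
          Real.norm_of_nonneg (Set.indicator_nonneg (fun _ _ => zero_le_one) _)]
        exact mul_le_one₀ h1 (Set.indicator_nonneg (fun _ _ => zero_le_one) _)
          (Set.indicator_le_self' (fun _ _ => zero_le_one) _)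
    refine h.congr ?_
    filter_upwards [ae_restrict_mem (measurableSet_unitCube d)] with t ht
    have h2 := Real.volume_Icc_pi_toReal (a := 0) (b := t) ht.1
    simp only [Pi.zero_apply, sub_zero] at h2
    rw [← h2, Measure.real]
  have havg : (∑ n, kernelProd (p n) y) / N = ∫ t in unitCube d,
      (∑ n, (upperBox (p n)).indicator (fun _ => (1 : ℝ)) t *
        (upperBox y).indicator (fun _ => (1 : ℝ)) t) / N := by
    rw [integral_div, integral_finsetSum _ fun n _ => integrable_indicator_mul_indicator _ _]
    simp only [kernelProd_eq_integral (hp _) hy]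
  rw [integral_kernelProd_left hy, havg, ← integral_sub hvol
    ((integrable_finsetSum _ fun n _ => integrable_indicator_mul_indicator _ _).div_const _),
    kernelProd_zero_eq_integral hy, ← integral_const_mul, ← Real.norm_eq_abs]
  refine norm_integral_le_of_norm_le ?_ ?_
  · exact ((integrable_const (1 : ℝ)).indicator (measurableSet_upperBox y)).const_mul _
  · filter_upwards [ae_all_iff.2 fun n => ae_indicator_upperBox_eq (hp n),
      ae_restrict_mem (measurableSet_unitCube d)] with t ht htC
    simp only [ht]
    rw [← Finset.sum_mul, mul_div_right_comm, ← sub_mul, norm_mul, Real.norm_eq_abs,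
      Real.norm_of_nonneg (Set.indicator_nonneg (fun _ _ => zero_le_one) _)]
    exact mul_le_mul_of_nonneg_right (abs_discrepancy_le p htC)
      (Set.indicator_nonneg (fun _ _ => zero_le_one) _)

/-- Source of `γ₀`: one factor `∫ (1 - u) du = 1/2` per coordinate. -/
lemma integral_kernelProd_zero (d : ℕ) :
    ∫ x in unitCube d, kernelProd x 0 = (1 / 2) ^ d := by
  have hpi : (volume.restrict (unitCube d) : Measure (Fin d → ℝ)) =
      Measure.pi fun _ : Fin d => volume.restrict (Set.Icc (0 : ℝ) 1) := by
    rw [← Measure.restrict_pi_pi, ← volume_pi, Set.pi_univ_Icc]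
    rfl
  have h1 : ∫ u in Set.Icc (0 : ℝ) 1, (1 - max u 0) = 1 / 2 := by
    have : ∫ u in Set.Icc (0 : ℝ) 1, (1 - max u 0) = ∫ u in Set.Icc (0 : ℝ) 1, (1 - u) :=
      setIntegral_congr_fun measurableSet_Icc fun u hu => by simp [hu.1]
    rw [this, integral_Icc_eq_integral_Ioc, ← intervalIntegral.integral_of_le zero_le_one,
      intervalIntegral.integral_sub (by simp) (by simp)]
    norm_num
  simp only [kernelProd, Pi.zero_apply, hpi]
  rw [integral_fintype_prod_eq_pow (fun u : ℝ => 1 - max u 0), h1, Fintype.card_fin]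

/-! ### From the kernel to represented functions -/

section IsKernelRepresented

variable {d : ℕ} {f g : (Fin d → ℝ) → ℝ}

lemma IsKernelRepresented.sq_eq_integral_kernelProd (h : IsKernelRepresented f g)
    {x : Fin d → ℝ} (hx : x ∈ unitCube d) :
    f x ^ 2 = ∫ y in unitCube d, kernelProd x y * g y ^ 2 := by
  rw [h.sq_eq x hx]
  exact setIntegral_congr_fun (measurableSet_unitCube d) fun y hy => by
    simp only [samplingKernel_eq_prod hx hy, kernelProd]

lemma IsKernelRepresented.integrable_kernelProd_mul (h : IsKernelRepresented f g)
    {x : Fin d → ℝ} (hx : x ∈ unitCube d) :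
    Integrable (fun y => kernelProd x y * g y ^ 2) (volume.restrict (unitCube d)) := by
  refine h.memLp_right.integrable_sq.bdd_mul (c := 1) ?_ ?_
  · exact (continuous_kernelProd.comp (Continuous.prodMk_right x)).aestronglyMeasurable
  · filter_upwards [ae_restrict_mem (measurableSet_unitCube d)] with y hy
    rw [Real.norm_of_nonneg (kernelProd_nonneg hx hy)]
    exact kernelProd_le_one hx hy

lemma IsKernelRepresented.integrable_prod (h : IsKernelRepresented f g) :
    Integrable (Function.uncurry fun x y => kernelProd x y * g y ^ 2)
      ((volume.restrict (unitCube d)).prod (volume.restrict (unitCube d))) := by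
  refine (h.memLp_right.integrable_sq.comp_snd (volume.restrict (unitCube d))).bdd_mul
    (c := 1) continuous_kernelProd.aestronglyMeasurable ?_
  have h1 := (Measure.quasiMeasurePreserving_fst (μ := volume.restrict (unitCube d))
    (ν := volume.restrict (unitCube d))).ae (ae_restrict_mem (measurableSet_unitCube d))
  have h2 := (Measure.quasiMeasurePreserving_snd (μ := volume.restrict (unitCube d))
    (ν := volume.restrict (unitCube d))).ae (ae_restrict_mem (measurableSet_unitCube d))
  filter_upwards [h1, h2] with z hz1 hz2
  rw [Real.norm_of_nonneg (kernelProd_nonneg hz1 hz2)]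
  exact kernelProd_le_one hz1 hz2

lemma IsKernelRepresented.l2NormSq_eq (h : IsKernelRepresented f g) :
    l2NormSq f = ∫ y in unitCube d, (∫ x in unitCube d, kernelProd x y) * g y ^ 2 := by
  calc l2NormSq f = ∫ x in unitCube d, ∫ y in unitCube d, kernelProd x y * g y ^ 2 :=
        setIntegral_congr_fun (measurableSet_unitCube d)
          fun x hx => h.sq_eq_integral_kernelProd hx
    _ = ∫ y in unitCube d, ∫ x in unitCube d, kernelProd x y * g y ^ 2 :=
        integral_integral_swap h.integrable_prod
    _ = _ := by simp only [integral_mul_const]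

/-- The kernel estimate at each `y`, integrated against the nonnegative weight `g²`; the bound
`K(0,y)` integrates to `f(0)²`. -/
lemma IsKernelRepresented.abs_l2NormSq_sub_average_le (h : IsKernelRepresented f g) {N : ℕ}
    {p : Fin N → Fin d → ℝ} (hp : ∀ n, p n ∈ unitCube d) :
    |l2NormSq f - (∑ n, f (p n) ^ 2) / N| ≤ starDiscrepancy p * f 0 ^ 2 := by
  have hint : Integrable (fun y => (∫ x in unitCube d, kernelProd x y) * g y ^ 2)
      (volume.restrict (unitCube d)) := by
    simpa only [Function.uncurry, integral_mul_const] using h.integrable_prod.integral_prod_right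
  have havg : (∑ n, f (p n) ^ 2) / N =
      ∫ y in unitCube d, (∑ n, kernelProd (p n) y * g y ^ 2) / N := by
    rw [integral_div, integral_finsetSum _ fun n _ => h.integrable_kernelProd_mul (hp n)]
    simp only [h.sq_eq_integral_kernelProd (hp _)]
  rw [h.l2NormSq_eq, havg, ← integral_sub hint
    ((integrable_finsetSum _ fun n _ => h.integrable_kernelProd_mul (hp n)).div_const _),
    h.sq_eq_integral_kernelProd (zero_mem_unitCube d), ← integral_const_mul, ← Real.norm_eq_abs]
  refine norm_integral_le_of_norm_le
    ((h.integrable_kernelProd_mul (zero_mem_unitCube d)).const_mul _) ?_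
  filter_upwards [ae_restrict_mem (measurableSet_unitCube d)] with y hy
  rw [← Finset.sum_mul, mul_div_right_comm, ← sub_mul, norm_mul, Real.norm_eq_abs,
    Real.norm_of_nonneg (sq_nonneg (g y)), ← mul_assoc]
  exact mul_le_mul_of_nonneg_right (abs_integral_kernelProd_sub_average_le hp hy) (sq_nonneg _)

lemma IsKernelRepresented.sq_zero_le_l2NormSq_right (h : IsKernelRepresented f g) :
    f 0 ^ 2 ≤ l2NormSq g := by
  rw [h.sq_eq_integral_kernelProd (zero_mem_unitCube d)]
  exact setIntegral_mono_on (h.integrable_kernelProd_mul (zero_mem_unitCube d))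
    h.memLp_right.integrable_sq (measurableSet_unitCube d) fun y hy =>
      mul_le_of_le_one_left (sq_nonneg _) (kernelProd_le_one (zero_mem_unitCube d) hy)

/-- Supermultiplicativity of the kernel gives `f(x)² ≥ K(x,0) f(0)²`; integrate in `x`. -/
lemma IsKernelRepresented.mul_sq_zero_le_l2NormSq (h : IsKernelRepresented f g) :
    (1 / 2) ^ d * f 0 ^ 2 ≤ l2NormSq f := by
  rw [← integral_kernelProd_zero d, ← integral_mul_const]
  refine setIntegral_mono_on ?_ h.memLp_left.integrable_sq (measurableSet_unitCube d)
    fun x hx => ?_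
  · refine Integrable.mul_const ?_ _
    refine ContinuousOn.integrableOn_compact (K := unitCube d) isCompact_Icc ?_
    exact (continuous_kernelProd.comp (Continuous.prodMk_left 0)).continuousOn
  · rw [h.sq_eq_integral_kernelProd hx, h.sq_eq_integral_kernelProd (zero_mem_unitCube d),
      ← integral_const_mul]
    refine setIntegral_mono_on
      ((h.integrable_kernelProd_mul (zero_mem_unitCube d)).const_mul _)
      (h.integrable_kernelProd_mul hx) (measurableSet_unitCube d) fun y hy => ?_
    rw [← mul_assoc]
    exact mul_le_mul_of_nonneg_right (kernelProd_mul_le hx hy) (sq_nonneg _)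

/-- Both choices of `γ` in the theorem enter only through `γ f(0)² ≤ ‖f‖²`. -/
lemma IsKernelRepresented.samplingInequality (h : IsKernelRepresented f g) {N : ℕ}
    {p : Fin N → Fin d → ℝ} (hp : ∀ n, p n ∈ unitCube d) {γ : ℝ} (hγ : 0 < γ)
    (hle : γ * f 0 ^ 2 ≤ l2NormSq f) : SamplingInequality γ p f := by
  have hD := h.abs_l2NormSq_sub_average_le hp
  have hbound : starDiscrepancy p * f 0 ^ 2 ≤ starDiscrepancy p / γ * l2NormSq f := by
    rw [div_mul_eq_mul_div, le_div_iff₀ hγ, mul_assoc, mul_comm _ γ]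
    exact mul_le_mul_of_nonneg_left hle (starDiscrepancy_nonneg p)
  obtain ⟨h1, h2⟩ := abs_le.1 (hD.trans hbound)
  rw [SamplingInequality, one_div_mul_eq_div]
  constructor <;> linarith

end IsKernelRepresented

/-! ### Samples lie in the cube; conclusion -/

lemma IsHilbertCurve.mapsTo {d : ℕ} {H : ℝ → Fin d → ℝ} (hH : IsHilbertCurve d H) :
    Set.MapsTo H (Set.Icc 0 1) (unitCube d) := by
  obtain ⟨c, hc, -⟩ := hH.exists_order 0
  intro t ht
  have h : H t ∈ dyadicCube d 0 (c ⟨0, by simp⟩) := by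
    rw [← hc]
    exact ⟨t, by simpa using ht, rfl⟩
  have hz : ∀ i, ((c ⟨0, by simp⟩ i : Fin (2 ^ 0)) : ℕ) = 0 := fun i => by
    have := (c ⟨0, by simp⟩ i).isLt
    simp only [pow_zero] at this
    omega
  constructor
  · intro i
    simpa [hz] using h.1 i
  · intro i
    simpa [hz] using h.2 i

lemma IsHSFCSample.ae_mem_unitCube {Ω : Type*} [MeasurableSpace Ω] {P : Measure Ω} {d N : ℕ}
    {H : ℝ → Fin d → ℝ} {X : Fin N → Ω → Fin d → ℝ} (hX : IsHSFCSample P N H X)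
    (hH : IsHilbertCurve d H) : ∀ᵐ ω ∂P, ∀ n, X n ω ∈ unitCube d := by
  obtain ⟨x, hx, -, hunif, hXx⟩ := hX
  refine ae_all_iff.2 fun n => ?_
  have hmem : ∀ᵐ t ∂P.map (x n), t ∈ Set.Icc ((n : ℕ) / N : ℝ) (((n : ℕ) + 1) / N) := by
    have := hunif n
    rw [pdf.IsUniform] at this
    rw [this, ProbabilityTheory.cond]
    exact Measure.ae_smul_measure (ae_restrict_mem measurableSet_Icc) _
  filter_upwards [ae_of_ae_map (hx n).aemeasurable hmem] with ω hω
  rw [hXx]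
  have hN : (0 : ℝ) < N := by exact_mod_cast n.pos
  refine hH.mapsTo ⟨(by positivity : (0 : ℝ) ≤ (n : ℕ) / N).trans hω.1,
    hω.2.trans ((div_le_one hN).2 ?_)⟩
  exact_mod_cast n.isLt

theorem mainTheorem6 (d : ℕ) (hd : 1 ≤ d) :
    ∃ γ₀ : ℝ, 0 < γ₀ ∧ γ₀ ≤ 1 ∧
      ∀ (b m : ℕ), 1 ≤ b → 1 ≤ m →
      ∀ (H : ℝ → Fin d → ℝ), IsHilbertCurve d H →
      ∀ (Ω : Type*) [MeasurableSpace Ω] (P : Measure Ω) [IsProbabilityMeasure P]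
        (X : Fin (b ^ m) → Ω → Fin d → ℝ), IsHSFCSample P (b ^ m) H X →
      ∀ ε : ℝ, 0 < ε → ε < 1 →
        ∃ A : Set Ω, MeasurableSet A ∧ 1 - ε ≤ P.real A ∧
          ∀ ω ∈ A, ∀ f g : (Fin d → ℝ) → ℝ, IsKernelRepresented f g →
            SamplingInequality γ₀ (fun j => X j ω) f ∧
            ∀ γ : ℝ, 0 < γ → γ ≤ 1 → γ * l2NormSq g ≤ l2NormSq f →
              SamplingInequality γ (fun j => X j ω) f := by
  refine ⟨(1 / 2) ^ d, by positivity, pow_le_one₀ (by norm_num) (by norm_num), ?_⟩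
  intro b m _ _ H hH Ω _ P _ X hX ε hε _
  -- The exceptional null set need not be measurable, since `H` is arbitrary off `[0,1]`; a
  -- measurable null superset makes the event have probability one, whatever `ε`.
  obtain ⟨B, hBsub, hBm, hB⟩ :=
    exists_measurable_superset_of_null (ae_iff.1 (hX.ae_mem_unitCube hH))
  refine ⟨Bᶜ, hBm.compl, ?_, fun ω hω f g h => ?_⟩
  · rw [probReal_compl_eq_one_sub hBm, Measure.real, hB, ENNReal.toReal_zero]
    linarith
  · have hp : ∀ j, X j ω ∈ unitCube d := not_not.1 fun hn => hω (hBsub hn)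
    refine ⟨h.samplingInequality hp (by positivity) h.mul_sq_zero_le_l2NormSq,
      fun γ hγ _ hle => h.samplingInequality hp hγ ?_⟩
    exact (mul_le_mul_of_nonneg_left h.sq_zero_le_l2NormSq_right hγ.le).trans hle
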